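/- Let $\lambda<4\pi^2$. On the real Hilbert space $L^2(0,1)$ with norm $\|\cdot\|$ let $\mathcal A w=-w_{\xi\xi\xi\xi}-\lambda w_{\xi\xi}$ with domain $D(\mathcal A)=H^4(0,1)\cap H^2_0(0,1)$. Then $-\mathcal A$ has a smallest eigenvalue $\sigma(\lambda)$, it is positive, and the following holds. For every $r\in(0,1)$ let $b(\cdot\,;r)\in C^1[0,1]$. Let $r\in(0,1)$, $\tau>0$, $w_0\in H^1_0(0,1)$ and $u\in L^2(0,\tau)$ (real-valued). Let $w$ be a strict solution on $[0,\tau]$ of the controlled Kuramoto–Sivashinsky system $$w_t+w_{\xi\xi\xi\xi}+\lambda w_{\xi\xi}+w\,w_\xi=b(\xi;r)\,u(t),\qquad w(0,t)=w(1,t)=w_\xi(0,t)=w_\xi(1,t)=0,\qquad w(\xi,0)=w_0(\xi),$$ that is, $w\in W^{1,2}(0,\tau;L^2(0,1))\cap L^2(0,\tau;D(\mathcal A))$ (continuous representative), $w(0)=w_0$, and $\dot w(t)=\mathcal A w(t)-w(t)w_\xi(t)+b(\cdot\,;r)u(t)$ in $L^2(0,1)$ for almost every $t\in[0,\tau]$.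 Then $$\|w(\tau)\|^2\le\|w_0\|^2+\frac1{\sigma(\lambda)}\,\|u\|_{L^2(0,\tau)}^2\,\max_{\xi\in[0,1]}b^2(\xi;r).$$ -/

import Mathlib

open MeasureTheory Set
open scoped ContDiff

noncomputable section

namespace KS

/-- Lebesgue measure on the open unit interval `(0, 1)`. -/
abbrev unitMeasure : Measure ℝ := volume.restrict (Ioo (0 : ℝ) 1)

/-- The state space `L²(0,1)` (real-valued). -/
abbrev State : Type := Lp ℝ 2 unitMeasure

/-- Test functions: smooth functions with compact support contained in `(0, 1)`. -/
structure IsTest (φ : ℝ → ℝ) : Prop where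
  smooth : ContDiff ℝ ∞ φ
  compact : HasCompactSupport φ
  supp : tsupport φ ⊆ Ioo 0 1

/-- `g` is the weak (distributional) derivative of order `k` of `f` on `(0, 1)`. -/
def IsWeakDeriv (k : ℕ) (f g : State) : Prop :=
  ∀ φ : ℝ → ℝ, IsTest φ →
    ∫ ξ, f ξ * iteratedDeriv k φ ξ ∂unitMeasure = (-1) ^ k * ∫ ξ, g ξ * φ ξ ∂unitMeasure

open Classical in
/-- The weak derivative of order `k` of `f`; the value `0` is a default which is used only if `f`
has no weak derivative of order `k` in `L²(0,1)`. -/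
def weakDeriv (k : ℕ) (f : State) : State :=
  if h : ∃ g, IsWeakDeriv k f g then h.choose else 0

/-- The Sobolev space `H^k(0,1)`. -/
def sobolev (k : ℕ) : Set State :=
  {f | ∀ j ≤ k, ∃ g, IsWeakDeriv j f g}

/-- The space `H^k_0(0,1)`, the closure of the test functions in `H^k(0,1)`. -/
def sobolevZero (k : ℕ) : Set State :=
  {f | f ∈ sobolev k ∧ ∀ ε : ℝ, 0 < ε → ∃ φ : ℝ → ℝ, IsTest φ ∧
    ∀ j ≤ k, eLpNorm (fun ξ => weakDeriv j f ξ - iteratedDeriv j φ ξ) 2 unitMeasure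
      < ENNReal.ofReal ε}

/-- The domain `H⁴(0,1) ∩ H²₀(0,1)` of the linear operator (clamped boundary conditions). -/
def domainA : Set State := sobolev 4 ∩ sobolevZero 2

/-- The operator `A w = - w_ξξξξ - lam w_ξξ`, to be applied to elements of `domainA`. -/
def opA (lam : ℝ) (w : State) : State := -weakDeriv 4 w - lam • weakDeriv 2 w

/-- The set of eigenvalues of `-A`. -/
def eigenvaluesNegA (lam : ℝ) : Set ℝ :=
  {μ | ∃ w ∈ domainA, w ≠ 0 ∧ -opA lam w = μ • w}

/-- The smallest eigenvalue `σ(lam)` of `-A`. -/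
def sigma (lam : ℝ) : ℝ := sInf (eigenvaluesNegA lam)

/-- The nonlinear term `F(w) = - w w_ξ`, as a function of `ξ`. -/
def nonlinF (w : State) : ℝ → ℝ := fun ξ => -(w ξ * weakDeriv 1 w ξ)

/-- `v` is the time derivative of `w`, and `w` belongs to `W^{1,2}(0,τ; L²(0,1))`
(`w` being the continuous representative): `w` is the primitive of a function in
`L²(0,τ; L²(0,1))`. -/
structure HasTimeDeriv (τ : ℝ) (w v : ℝ → State) : Prop where
  memLp : MemLp v 2 (volume.restrict (Ioo 0 τ))
  primitive : ∀ t ∈ Icc 0 τ, w t = w 0 + ∫ s in (0 : ℝ)..t, v s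

/-- `w` belongs to `L²(0,τ; D(A))`, where `D(A)` carries the graph norm. -/
structure MemL2Domain (lam τ : ℝ) (w : ℝ → State) : Prop where
  mem : ∀ᵐ t ∂(volume.restrict (Ioo 0 τ)), w t ∈ domainA
  memLp : MemLp w 2 (volume.restrict (Ioo 0 τ))
  memLp_opA : MemLp (fun t => opA lam (w t)) 2 (volume.restrict (Ioo 0 τ))

/-- `w` is a strict solution on `[0, τ]` of the controlled Kuramoto–Sivashinsky equation
`w' = A w + F(w) + β u`, `w(0) = w₀`: it lies in `W^{1,2}(0,τ; L²) ∩ L²(0,τ; D(A))`, takes the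
initial value, and satisfies the equation in `L²(0,1)` for almost every `t`. -/
def IsStrictSolution (lam τ : ℝ) (β : ℝ → ℝ) (u : ℝ → ℝ) (w₀ : State) (w : ℝ → State) : Prop :=
  w 0 = w₀ ∧ MemL2Domain lam τ w ∧
    ∃ v : ℝ → State, HasTimeDeriv τ w v ∧
      ∀ᵐ t ∂(volume.restrict (Ioo 0 τ)), ∀ᵐ ξ ∂unitMeasure,
        v t ξ = opA lam (w t) ξ + nonlinF (w t) ξ + β ξ * u t

lemma IsTest.integrable_mul {φ : ℝ → ℝ} (hφ : IsTest φ) (g : State) :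
    Integrable (fun ξ => g ξ * φ ξ) unitMeasure := by
  have h1 : MemLp φ 2 unitMeasure :=
    (hφ.smooth.continuous.memLp_of_hasCompactSupport hφ.compact)
  exact (Lp.memLp g).integrable_mul h1

/-- Weak derivatives are unique. -/
lemma IsWeakDeriv.unique {k : ℕ} {f g h : State} (hg : IsWeakDeriv k f g)
    (hh : IsWeakDeriv k f h) : g = h := by
  have key : ∀ᵐ ξ ∂volume, ξ ∈ Ioo (0 : ℝ) 1 → (g - h : ℝ → ℝ) ξ = 0 := by
    refine IsOpen.ae_eq_zero_of_integral_contDiff_smul_eq_zero (E := ℝ) (F := ℝ)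
      (isOpen_Ioo (a := (0 : ℝ)) (b := 1)) ?_ ?_
    · have h1 : Integrable (g - h : ℝ → ℝ) unitMeasure :=
        ((Lp.memLp g).integrable one_le_two).sub ((Lp.memLp h).integrable one_le_two)
      exact IntegrableOn.locallyIntegrableOn h1
    · intro φ h1 h2 h3
      have ht : IsTest φ := ⟨h1, h2, h3⟩
      have e : ∫ ξ, g ξ * φ ξ ∂unitMeasure = ∫ ξ, h ξ * φ ξ ∂unitMeasure := by
        have := (hg φ ht).symm.trans (hh φ ht)
        exact mul_left_cancel₀ (pow_ne_zero _ (by norm_num)) this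
      refine (setIntegral_eq_integral_of_forall_compl_eq_zero (E := ℝ) (μ := volume)
          (s := Ioo (0 : ℝ) 1) ?_).symm.trans ?_
      · intro ξ hξ
        have : φ ξ = 0 := image_eq_zero_of_notMem_tsupport fun h => hξ (h3 h)
        simp [this]
      · have e2 : ∫ ξ, (g ξ * φ ξ - h ξ * φ ξ) ∂unitMeasure = 0 := by
          rw [integral_sub (ht.integrable_mul g) (ht.integrable_mul h), e, sub_self]
        refine Eq.trans ?_ e2
        congr 1
        funext ξ
        simp only [Pi.sub_apply, smul_eq_mul]
        ring
  apply Lp.ext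
  have := (ae_restrict_iff' measurableSet_Ioo).2 key
  filter_upwards [this] with ξ hξ
  exact sub_eq_zero.1 hξ

lemma IsWeakDeriv.weakDeriv_eq {k : ℕ} {f g : State} (hg : IsWeakDeriv k f g) :
    weakDeriv k f = g := by
  have h : ∃ g, IsWeakDeriv k f g := ⟨g, hg⟩
  unfold weakDeriv
  rw [dif_pos h]
  exact h.choose_spec.unique hg

end KS

end

/-! A clamped function is recovered from its second derivative `g` by integrating twice, so `H²₀` is
replaced by a closed subspace `clamped` of `L²`, and `w = V (V g)` with `V` the Volterra operator
`volterra`. The form of `-A` becomes `⟪g, k⟫ - lam ⟪V g, V k⟫`. Since `V g = w_ξ` vanishes at both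
ends and has mean zero, Wirtinger's inequality `4π² ‖V g‖² ≤ ‖g‖²` makes the form coercive for `lam
< 4π²` (`isCoercive_energyForm`).

As `V` is compact, the least Rayleigh quotient is positive and attained (`exists_least_rayleigh`).
The minimizer is a weak eigenfunction, and it lies in `H⁴` because the weak equation identifies
`g''` (`mem_domainA_of_form`). Hence `σ` is the least eigenvalue and `σ ‖w‖² ≤ ⟪-A w, w⟫` on the
domain (`isLeast_sigma`).

Along a strict solution `‖w‖²` is absolutely continuous with derivative `2 ⟪w, w'⟫`
(`norm_sq_primitive`). The nonlinearity drops out, since `w² w_ξ = (w³/3)_ξ` integrates to zero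
(`nonlinF_energy`). Young's inequality absorbs the control term into the dissipation, and
integration in time gives the bound. -/

noncomputable section

namespace KS

open scoped RealInnerProductSpace InnerProductSpace Topology

/-! ### Coercive forms and compact embeddings -/

/-- Variational characterization of the smallest eigenvalue of a coercive symmetric form relative
to a compact embedding. -/
theorem exists_least_rayleigh {E H : Type*} [NormedAddCommGroup E] [InnerProductSpace ℝ E]
    [CompleteSpace E] [NormedAddCommGroup H] [InnerProductSpace ℝ H] [CompleteSpace H]
    (J : E →L[ℝ] H) (hJ : IsCompactOperator J) (hJ0 : J ≠ 0) (a : E →L[ℝ] E →L[ℝ] ℝ)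
    (ha : IsCoercive a) (hsymm : ∀ x y, a x y = a y x) :
    ∃ σ : ℝ, 0 < σ ∧ (∀ g, σ * ‖J g‖ ^ 2 ≤ a g g) ∧
      ∃ g, J g ≠ 0 ∧ ∀ h, a g h = σ * ⟪J g, J h⟫ := by
  -- `S` is the Lax–Milgram solution operator; `T = J S J*` is compact, symmetric and nonnegative on
  -- `H`, and `σ` will be `‖T‖⁻¹`.
  let S : E →L[ℝ] E := (ha.continuousLinearEquivOfBilin.symm : E →L[ℝ] E)
  have hS : ∀ x y, a (S x) y = ⟪x, y⟫ := fun x y => by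
    rw [← ha.continuousLinearEquivOfBilin_apply]
    simp [S]
  have hS' : ∀ x y, ⟪S x, y⟫ = ⟪x, S y⟫ := fun x y => by
    rw [← hS x (S y), hsymm, hS y (S x), real_inner_comm]
  let T : H →L[ℝ] H := J ∘L S ∘L J.adjoint
  have hT : ∀ f f', ⟪T f, f'⟫ = ⟪S (J.adjoint f), J.adjoint f'⟫ := fun f f' => by
    simp [T, ContinuousLinearMap.adjoint_inner_right]
  have hTc : IsCompactOperator T := hJ.comp_clm (S ∘L J.adjoint)
  have hTs : T.IsSymmetric := fun f f' => by
    change ⟪T f, f'⟫ = ⟪f, T f'⟫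
    rw [hT, hS', real_inner_comm, ← hT, real_inner_comm]
  have hnn : ∀ x, 0 ≤ a x x := fun x => by
    obtain ⟨C, hC, h⟩ := ha
    exact le_trans (by positivity) (h x)
  have hpos : ∀ x, x ≠ 0 → 0 < a x x := fun x hx => by
    obtain ⟨C, hC, h⟩ := ha
    have := norm_pos_iff.2 hx
    exact lt_of_lt_of_le (by positivity) (h x)
  have hTp : ∀ f, ⟪T f, f⟫ = a (S (J.adjoint f)) (S (J.adjoint f)) := fun f => by
    rw [hT, hS, real_inner_comm]
  have hT0 : T ≠ 0 := by
    intro h0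
    apply hJ0
    ext g
    by_contra hg
    have h1 : J.adjoint (J g) ≠ 0 := by
      intro h
      apply hg
      have : ⟪J g, J g⟫ = 0 := by
        rw [← ContinuousLinearMap.adjoint_inner_left, h, inner_zero_left]
      simpa using this
    have h2 : S (J.adjoint (J g)) ≠ 0 := by simpa [S] using h1
    have := hpos _ h2
    rw [← hTp, h0] at this
    simp at this
  have hm : 0 < ‖T‖ := norm_pos_iff.2 hT0
  have hnt : Nontrivial H := by
    by_contra h
    rw [not_nontrivial_iff_subsingleton] at h
    exact hT0 (Subsingleton.elim _ _)
  -- By the Fredholm alternative, if `‖T‖` is not an eigenvalue it is in the resolvent set. The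
  -- Rayleigh quotients would then stay a fixed `ε` below `‖T‖`, although, being nonnegative, they
  -- have supremum `‖T‖`.
  have hev : Module.End.HasEigenvalue (T : Module.End ℝ H) ‖T‖ := by
    rcases hTc.hasEigenvalue_or_mem_resolventSet hm.ne' with h | h
    · exact h
    · exfalso
      obtain ⟨ε, hε, hb⟩ := T.rayleighQuotient_le_of_norm_mem_resolventSet h
      have h1 := T.norm_eq_iSup_rayleighQuotient hTs
      have h2 : (⨆ x, |T.rayleighQuotient x|) ≤ ‖T‖ - ε := ciSup_le fun x => by
        rw [abs_of_nonneg]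
        · exact hb x
        · apply div_nonneg _ (by positivity)
          rw [ContinuousLinearMap.reApplyInnerSelf_apply]
          change 0 ≤ ⟪T x, x⟫
          rw [hTp]
          exact hnn _
      linarith
  refine ⟨‖T‖⁻¹, inv_pos.2 hm, fun g => ?_, ?_⟩
  -- Here `a p g = ‖J g‖²` and `a p p ≤ ‖T‖ ‖J g‖²`; expanding `0 ≤ a (p - ‖T‖ g) (p - ‖T‖ g)` gives
  -- the bound.
  · set p := S (J.adjoint (J g)) with hp
    have h1 : a p p ≤ ‖T‖ * ‖J g‖ ^ 2 := by
      rw [hp, ← hTp]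
      calc ⟪T (J g), J g⟫ ≤ ‖T (J g)‖ * ‖J g‖ := real_inner_le_norm _ _
        _ ≤ ‖T‖ * ‖J g‖ * ‖J g‖ := by gcongr; exact T.le_opNorm _
        _ = _ := by ring
    have h2 : a p g = ‖J g‖ ^ 2 := by
      rw [hp, hS, ContinuousLinearMap.adjoint_inner_left, real_inner_self_eq_norm_sq]
    have h3 := hnn (p - ‖T‖ • g)
    simp only [map_sub, map_smul, sub_apply, smul_apply,
      smul_eq_mul] at h3
    rw [hsymm g p, h2] at h3
    rw [inv_mul_le_iff₀ hm]
    have h4 : ‖T‖ * ‖J g‖ ^ 2 ≤ ‖T‖ * (‖T‖ * a g g) := by nlinarith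
    exact le_of_mul_le_mul_left h4 hm
  · obtain ⟨f, hf⟩ := hev.exists_hasEigenvector
    have hTf : T f = ‖T‖ • f := hf.apply_eq_smul
    refine ⟨S (J.adjoint f), ?_, fun h => ?_⟩
    · change T f ≠ 0
      rw [hTf]
      exact smul_ne_zero hm.ne' hf.2
    · rw [hS, ContinuousLinearMap.adjoint_inner_left]
      change _ = _ * ⟪T f, J h⟫
      rw [hTf, real_inner_smul_left, inv_mul_cancel_left₀ hm.ne']

/-! ### Wirtinger's inequality by Parseval -/

/-- Wirtinger's inequality for functions with period one and mean zero. -/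
theorem wirtinger {f f' : ℝ → ℝ} (hf : ∀ x, HasDerivAt f (f' x) x) (hf' : Continuous f')
    (hper : f 0 = f 1) (hmean : ∫ x in (0 : ℝ)..1, f x = 0) :
    4 * Real.pi ^ 2 * ∫ x in (0 : ℝ)..1, f x ^ 2 ≤ ∫ x in (0 : ℝ)..1, f' x ^ 2 := by
  have h01 : (0 : ℝ) < 1 := one_pos
  have hfc : Continuous f := continuous_iff_continuousAt.2 fun x => (hf x).continuousAt
  have hL : ∀ g : ℝ → ℝ, Continuous g →
      HasSum (fun i => ‖fourierCoeffOn h01 (fun x => (g x : ℂ)) i‖ ^ 2)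
        (∫ x in (0 : ℝ)..1, g x ^ 2) := fun g hg => by
    have hc : Continuous fun x => (g x : ℂ) := Complex.continuous_ofReal.comp hg
    have h := hasSum_sq_fourierCoeffOn h01 (f := fun x => (g x : ℂ)) (by
      refine (memLp_two_iff_integrable_sq_norm hc.aestronglyMeasurable).2 ?_
      exact ((hc.norm.pow 2).integrableOn_Icc (a := 0) (b := 1)).mono_set Ioc_subset_Icc_self)
    simpa using h
  have h1 := (hL f hfc).mul_left (4 * Real.pi ^ 2)
  refine hasSum_le (fun n => ?_) h1 (hL f' hf')
  by_cases hn : n = 0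
  -- The zeroth coefficient is the mean, hence zero; for `n ≠ 0` periodicity gives `|f̂'(n)| = 2π|n|
  -- |f̂(n)|`.
  · subst hn
    have : fourierCoeffOn h01 (fun x => (f x : ℂ)) 0 = 0 := by
      rw [fourierCoeffOn_eq_integral]
      simp [intervalIntegral.integral_ofReal, hmean]
    rw [this]
    simp
  · have h2 := fourierCoeffOn_of_hasDerivAt h01 (f := fun x => (f x : ℂ))
      (f' := fun x => (f' x : ℂ)) hn (fun x _ => (hf x).ofReal_comp)
      ((Complex.continuous_ofReal.comp hf').intervalIntegrable _ _)
    rw [hper, sub_self, mul_zero, zero_sub, Complex.ofReal_one, Complex.ofReal_zero, sub_zero,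
      one_mul] at h2
    have hn1 : (1 : ℝ) ≤ (n : ℝ) ^ 2 := by
      have : (1 : ℤ) ≤ n ^ 2 := by have := sq_pos_of_ne_zero hn; omega
      exact_mod_cast this
    have hpi := Real.pi_pos
    have h3 : ‖fourierCoeffOn h01 (fun x => (f' x : ℂ)) n‖
        = 2 * Real.pi * |(n : ℝ)| * ‖fourierCoeffOn h01 (fun x => (f x : ℂ)) n‖ := by
      have hn0 : |(n : ℝ)| ≠ 0 := by simpa using hn
      rw [h2]
      simp only [norm_mul, norm_neg, norm_div, norm_one, Complex.norm_ofNat, Complex.norm_I,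
        Complex.norm_real, Complex.norm_intCast, Real.norm_eq_abs, abs_of_pos hpi]
      field_simp
    change _ ≤ ‖fourierCoeffOn h01 (fun x => (f' x : ℂ)) n‖ ^ 2
    rw [h3, mul_pow, mul_pow, sq_abs, mul_pow]
    have : 0 ≤ Real.pi ^ 2 * ‖fourierCoeffOn h01 (fun x => (f x : ℂ)) n‖ ^ 2 := by positivity
    nlinarith

/-! ### The Volterra operator and its compactness -/

lemma inner_eq_integral (f g : State) : ⟪f, g⟫ = ∫ ξ, f ξ * g ξ ∂unitMeasure := by
  rw [L2.inner_def]
  simp [mul_comm]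

lemma integral_unit_eq (f : ℝ → ℝ) : ∫ ξ, f ξ ∂unitMeasure = ∫ ξ in (0 : ℝ)..1, f ξ := by
  rw [intervalIntegral.integral_of_le zero_le_one, integral_Ioc_eq_integral_Ioo]

lemma State.intervalIntegrable (g : State) : IntervalIntegrable (g : ℝ → ℝ) volume 0 1 := by
  rw [intervalIntegrable_iff_integrableOn_Ioo_of_le zero_le_one]
  exact (Lp.memLp g).integrable one_le_two

lemma State.intervalIntegrable_of_mem (g : State) {x y : ℝ} (hx : x ∈ Icc (0 : ℝ) 1)
    (hy : y ∈ Icc (0 : ℝ) 1) : IntervalIntegrable (g : ℝ → ℝ) volume x y :=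
  g.intervalIntegrable.mono_set (by
    rw [uIcc_of_le (zero_le_one' ℝ)]
    exact (convex_Icc (0 : ℝ) 1).ordConnected.uIcc_subset hx hy)

/-- The primitive vanishing at `0`. -/
def prim (g : ℝ → ℝ) (x : ℝ) : ℝ := ∫ s in (0 : ℝ)..x, g s

lemma prim_congr {f g : ℝ → ℝ} (h : f =ᵐ[unitMeasure] g) {x : ℝ} (hx : x ∈ Icc (0 : ℝ) 1) :
    prim f x = prim g x := by
  unfold prim
  rw [intervalIntegral.integral_of_le hx.1, intervalIntegral.integral_of_le hx.1,
    integral_Ioc_eq_integral_Ioo, integral_Ioc_eq_integral_Ioo]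
  exact integral_congr_ae (ae_restrict_of_ae_restrict_of_subset (Ioo_subset_Ioo_right hx.2) h)

lemma absolutelyContinuous_prim (g : State) : AbsolutelyContinuousOnInterval (prim g) 0 1 :=
  g.intervalIntegrable.absolutelyContinuousOnInterval_intervalIntegral (by simp)

lemma continuousOn_prim (g : State) : ContinuousOn (prim g) (Icc 0 1) := by
  have := (absolutelyContinuous_prim g).continuousOn
  rwa [uIcc_of_le (zero_le_one' ℝ)] at this

lemma ae_mem_unit : ∀ᵐ ξ ∂unitMeasure, ξ ∈ Ioo (0 : ℝ) 1 := ae_restrict_mem measurableSet_Ioo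

lemma memLp_unit_of_continuousOn {f : ℝ → ℝ} (hf : ContinuousOn f (Icc 0 1)) :
    MemLp f 2 unitMeasure := by
  obtain ⟨C, hC⟩ := isCompact_Icc.exists_bound_of_continuousOn hf
  refine MemLp.of_bound ((hf.mono Ioo_subset_Icc_self).aestronglyMeasurable measurableSet_Ioo) C ?_
  filter_upwards [ae_mem_unit] with x hx using hC x (Ioo_subset_Icc_self hx)

/-- The indicator function of `(x, y)` as an element of the state space. -/
def ind (x y : ℝ) : State :=
  indicatorConstLp 2 (measurableSet_Ioo (a := x) (b := y)) (measure_ne_top unitMeasure _) 1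

lemma inner_ind (g : State) {x y : ℝ} (hx : 0 ≤ x) (h : x ≤ y) (hy : y ≤ 1) :
    ⟪ind x y, g⟫ = ∫ s in x..y, g s := by
  rw [ind, L2.inner_indicatorConstLp_one, intervalIntegral.integral_of_le h,
    integral_Ioc_eq_integral_Ioo, Measure.restrict_restrict measurableSet_Ioo,
    inter_eq_left.2 (Ioo_subset_Ioo hx hy)]

lemma norm_ind {x y : ℝ} (hx : 0 ≤ x) (h : x ≤ y) (hy : y ≤ 1) :
    ‖ind x y‖ = Real.sqrt (y - x) := by
  rw [ind, norm_indicatorConstLp (by norm_num) (by norm_num)]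
  simp only [norm_one, one_mul, Measure.real, Measure.restrict_apply measurableSet_Ioo,
    inter_eq_left.2 (Ioo_subset_Ioo hx hy), Real.volume_Ioo, ENNReal.toReal_ofNat]
  rw [ENNReal.toReal_ofReal (by linarith), Real.sqrt_eq_rpow]

/-- The increments of a primitive satisfy the Cauchy-Schwarz bound. -/
lemma abs_integral_le (g : State) {x y : ℝ} (hx : 0 ≤ x) (h : x ≤ y) (hy : y ≤ 1) :
    |∫ s in x..y, g s| ≤ Real.sqrt (y - x) * ‖g‖ := by
  rw [← inner_ind g hx h hy, ← norm_ind hx h hy]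
  exact abs_real_inner_le_norm _ _

lemma norm_le_of_ae_bound (f : State) {C : ℝ} (hC : 0 ≤ C) (h : ∀ᵐ ξ ∂unitMeasure, |f ξ| ≤ C) :
    ‖f‖ ≤ C := by
  have := Lp.norm_le_of_ae_bound (f := f) hC h
  simpa [measureUnivNNReal] using this

/-- The Volterra operator. -/
def volterra : State →L[ℝ] State :=
  LinearMap.mkContinuous
    { toFun := fun g => (memLp_unit_of_continuousOn (continuousOn_prim g)).toLp
      map_add' := fun f g => by
        rw [← MemLp.toLp_add]
        refine MemLp.toLp_congr _ _ ?_
        filter_upwards [ae_mem_unit] with x hx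
        have hx' := Ioo_subset_Icc_self hx
        rw [prim_congr (Lp.coeFn_add f g) hx']
        exact intervalIntegral.integral_add
          (f.intervalIntegrable_of_mem (left_mem_Icc.2 zero_le_one) hx')
          (g.intervalIntegrable_of_mem (left_mem_Icc.2 zero_le_one) hx')
      map_smul' := fun c f => by
        rw [RingHom.id_apply, ← MemLp.toLp_const_smul]
        refine MemLp.toLp_congr _ _ ?_
        filter_upwards [ae_mem_unit] with x hx
        rw [prim_congr (Lp.coeFn_smul c f) (Ioo_subset_Icc_self hx)]
        exact intervalIntegral.integral_smul c _ } 1 (fun g => by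
    refine norm_le_of_ae_bound _ (by positivity) ?_
    filter_upwards [(memLp_unit_of_continuousOn (continuousOn_prim g)).coeFn_toLp, ae_mem_unit] with x hx hx1
    have hx' := Ioo_subset_Icc_self hx1
    change |((memLp_unit_of_continuousOn (continuousOn_prim g)).toLp : State) x| ≤ _
    rw [hx]
    refine (abs_integral_le g le_rfl hx'.1 hx'.2).trans ?_
    gcongr
    rw [Real.sqrt_le_one, sub_zero]
    exact hx'.2)

lemma volterra_coeFn (g : State) : volterra g =ᵐ[unitMeasure] prim g :=
  (memLp_unit_of_continuousOn (continuousOn_prim g)).coeFn_toLp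

lemma isCompactOperator_rankOne (a b : State) :
    IsCompactOperator ((innerSL ℝ a).smulRight b : State →L[ℝ] State) := by
  have h : IsCompactOperator (ContinuousLinearMap.toSpanSingleton ℝ b) :=
    isCompactOperator_of_locallyCompactSpace_rng (ContinuousLinearMap.toSpanSingleton ℝ b)
  exact h.comp_clm (innerSL ℝ a)

/-- Finite rank approximation of the Volterra operator: sample the primitive at `i / n`. -/
def volterraApprox (n : ℕ) : State →L[ℝ] State :=
  ∑ i ∈ Finset.range n, (innerSL ℝ (ind 0 (i / n))).smulRight (ind (i / n) ((i + 1) / n))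

lemma isCompactOperator_volterraApprox (n : ℕ) : IsCompactOperator (volterraApprox n) := by
  have : volterraApprox n ∈ compactOperator (RingHom.id ℝ) State State :=
    Submodule.sum_mem _ fun i _ => isCompactOperator_rankOne _ _
  exact this

lemma volterraApprox_coeFn {n : ℕ} (hn : 0 < n) (g : State) :
    ∀ᵐ x ∂unitMeasure, volterraApprox n g x = prim g (⌊n * x⌋₊ / n) := by
  have hn' : (0 : ℝ) < n := by exact_mod_cast hn
  have e : volterraApprox n g =
      ∑ i ∈ Finset.range n, prim g (i / n) • ind (i / n) ((i + 1) / n) := by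
    simp only [volterraApprox, sum_apply]
    refine Finset.sum_congr rfl fun i hi => ?_
    have hi' : (i : ℝ) ≤ n := by exact_mod_cast (Finset.mem_range.1 hi).le
    rw [ContinuousLinearMap.smulRight_apply, innerSL_apply_apply, inner_ind g le_rfl (by positivity)
      ((div_le_one hn').2 hi'), prim]
  have h1 : ∀ᵐ x ∂unitMeasure, ∀ i : ℕ, ind (i / n) ((i + 1) / n) x
      = (Ioo ((i : ℝ) / n) ((i + 1) / n)).indicator (fun _ => (1 : ℝ)) x :=
    ae_all_iff.2 fun i => indicatorConstLp_coeFn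
  have h2 : ∀ᵐ x ∂unitMeasure, ∀ i : ℕ, (prim g (i / n) • ind (i / n) ((i + 1) / n) : State) x
      = prim g (i / n) * ind (i / n) ((i + 1) / n) x :=
    ae_all_iff.2 fun i => Lp.coeFn_smul _ _
  -- The open intervals `(i/n, (i+1)/n)` miss the grid points, which form a null set.
  have h3 : ∀ᵐ x ∂unitMeasure, ∀ i : ℕ, x ≠ (i : ℝ) / n := ae_all_iff.2 fun i =>
    ae_restrict_of_ae (Measure.ae_ne volume _)
  have h4 := Lp.coeFn_fun_finsetSum (Finset.range n)
    (fun i : ℕ => (prim g (i / n) • ind (i / n) ((i + 1) / n) : State))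
  rw [e]
  filter_upwards [h1, h2, h3, h4, ae_mem_unit] with x h1 h2 h3 h4 hx
  rw [h4]
  have hfl := Nat.floor_le (a := n * x) (mul_nonneg hn'.le hx.1.le)
  have hfl' := Nat.lt_floor_add_one (n * x)
  rw [Finset.sum_eq_single ⌊n * x⌋₊]
  · rw [h2, h1, indicator_of_mem, mul_one]
    refine ⟨lt_of_le_of_ne ?_ (h3 _).symm, ?_⟩
    · rw [div_le_iff₀ hn']; linarith
    · rw [lt_div_iff₀ hn']; linarith
  · intro i _ hi
    rw [h2, h1, indicator_of_notMem, mul_zero]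
    rintro ⟨h5, h6⟩
    rw [div_lt_iff₀ hn'] at h5
    rw [lt_div_iff₀ hn'] at h6
    apply hi
    symm
    rw [Nat.floor_eq_iff (mul_nonneg hn'.le hx.1.le)]
    exact ⟨by linarith, by linarith⟩
  · intro h
    exfalso
    apply h
    rw [Finset.mem_range, Nat.floor_lt (mul_nonneg hn'.le hx.1.le)]
    nlinarith [hx.2]

/-- Sampling moves the evaluation point by at most `1/n`, and by Cauchy–Schwarz a primitive of `g`
is Hölder of exponent 1/2 with constant `‖g‖`. -/
lemma norm_volterraApprox_sub {n : ℕ} (hn : 0 < n) :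
    ‖volterraApprox n - volterra‖ ≤ Real.sqrt (1 / n) := by
  have hn' : (0 : ℝ) < n := by exact_mod_cast hn
  refine ContinuousLinearMap.opNorm_le_bound _ (Real.sqrt_nonneg _) fun g => ?_
  rw [sub_apply]
  refine norm_le_of_ae_bound _ (by positivity) ?_
  filter_upwards [volterraApprox_coeFn hn g, volterra_coeFn g, Lp.coeFn_sub (volterraApprox n g)
    (volterra g), ae_mem_unit] with x h1 h2 h3 hx
  have hx' := Ioo_subset_Icc_self hx
  have hfl := Nat.floor_le (a := n * x) (mul_nonneg hn'.le hx.1.le)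
  have hfl' := Nat.lt_floor_add_one (n * x)
  have h4 : (⌊n * x⌋₊ : ℝ) / n ≤ x := by rw [div_le_iff₀ hn']; linarith
  have h0 : (0 : ℝ) ≤ ⌊n * x⌋₊ / n := by positivity
  rw [h3, Pi.sub_apply, h1, h2, abs_sub_comm, prim, prim,
    intervalIntegral.integral_interval_sub_left
      (g.intervalIntegrable_of_mem (left_mem_Icc.2 zero_le_one) hx')
      (g.intervalIntegrable_of_mem (left_mem_Icc.2 zero_le_one) ⟨h0, h4.trans hx'.2⟩)]
  refine (abs_integral_le g h0 h4 hx'.2).trans ?_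
  gcongr
  rw [sub_le_iff_le_add, ← add_div, le_div_iff₀ hn']
  linarith

theorem isCompactOperator_volterra : IsCompactOperator volterra := by
  refine isCompactOperator_of_tendsto (l := Filter.atTop) (F := fun n : ℕ => volterraApprox n) ?_
    (Filter.Eventually.of_forall isCompactOperator_volterraApprox)
  rw [tendsto_iff_norm_sub_tendsto_zero]
  have h : Filter.Tendsto (fun n : ℕ => Real.sqrt (1 / n)) Filter.atTop (𝓝 0) := by
    have := (Real.continuous_sqrt.tendsto 0).comp tendsto_one_div_atTop_nhds_zero_nat
    simpa [Function.comp_def] using this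
  refine squeeze_zero' (Filter.Eventually.of_forall fun n => norm_nonneg _) ?_ h
  filter_upwards [Filter.eventually_gt_atTop 0] with n hn using norm_volterraApprox_sub hn

/-! ### Test functions and weak derivatives -/

namespace IsTest

variable {φ ψ : ℝ → ℝ}

lemma add (hφ : IsTest φ) (hψ : IsTest ψ) : IsTest (φ + ψ) where
  smooth := hφ.smooth.add hψ.smooth
  compact := hφ.compact.add hψ.compact
  supp := (tsupport_add φ ψ).trans (union_subset hφ.supp hψ.supp)

lemma zero : IsTest (0 : ℝ → ℝ) where
  smooth := contDiff_const
  compact := HasCompactSupport.zero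
  supp := by simp [tsupport]

lemma const_smul (c : ℝ) (hφ : IsTest φ) : IsTest (c • φ) where
  smooth := hφ.smooth.const_smul c
  compact := hφ.compact.mono (Function.support_const_smul_subset c φ)
  supp := (closure_mono (Function.support_const_smul_subset c φ)).trans hφ.supp

lemma deriv (hφ : IsTest φ) : IsTest (deriv φ) where
  smooth := (contDiff_infty_iff_deriv.1 hφ.smooth).2
  compact := hφ.compact.deriv
  supp := (tsupport_deriv_subset (f := φ)).trans hφ.supp

lemma iteratedDeriv (hφ : IsTest φ) (k : ℕ) : IsTest (iteratedDeriv k φ) := by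
  induction k with
  | zero => rwa [iteratedDeriv_zero]
  | succ k ih => rw [iteratedDeriv_succ]; exact ih.deriv

lemma eq_zero_of_notMem (hφ : IsTest φ) {x : ℝ} (hx : x ∉ Ioo (0 : ℝ) 1) : φ x = 0 :=
  image_eq_zero_of_notMem_tsupport fun h => hx (hφ.supp h)

lemma apply_zero (hφ : IsTest φ) : φ 0 = 0 := hφ.eq_zero_of_notMem (by simp)

lemma apply_one (hφ : IsTest φ) : φ 1 = 0 := hφ.eq_zero_of_notMem (by simp)

lemma hasDerivAt (hφ : IsTest φ) (x : ℝ) : HasDerivAt φ (_root_.deriv φ x) x :=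
  (hφ.smooth.differentiable (by simp) x).hasDerivAt

lemma continuous (hφ : IsTest φ) : Continuous φ := hφ.smooth.continuous

lemma memLp (hφ : IsTest φ) : MemLp φ 2 unitMeasure :=
  memLp_unit_of_continuousOn hφ.continuous.continuousOn

/-- A test function as an element of the state space. -/
def toState (hφ : IsTest φ) : State := hφ.memLp.toLp

lemma coeFn_toState (hφ : IsTest φ) : hφ.toState =ᵐ[unitMeasure] φ := hφ.memLp.coeFn_toLp

lemma inner_toState (hφ : IsTest φ) (g : State) : ⟪g, hφ.toState⟫ = ∫ ξ, g ξ * φ ξ ∂unitMeasure := by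
  rw [inner_eq_integral]
  refine integral_congr_ae ?_
  filter_upwards [hφ.coeFn_toState] with x hx
  rw [hx]

lemma prim_deriv (hφ : IsTest φ) (x : ℝ) : prim (_root_.deriv φ) x = φ x := by
  rw [prim, intervalIntegral.integral_eq_sub_of_hasDerivAt (fun y _ => hφ.hasDerivAt y)
    (hφ.deriv.continuous.intervalIntegrable _ _), hφ.apply_zero, sub_zero]

lemma volterra_deriv (hφ : IsTest φ) : volterra hφ.deriv.toState = hφ.toState := by
  apply Lp.ext
  filter_upwards [volterra_coeFn hφ.deriv.toState, hφ.coeFn_toState, ae_mem_unit] with x h1 h2 hx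
  rw [h1, h2, prim_congr hφ.deriv.coeFn_toState (Ioo_subset_Icc_self hx), hφ.prim_deriv]

end IsTest

lemma isWeakDeriv_iff {k : ℕ} {f g : State} : IsWeakDeriv k f g ↔ ∀ (φ : ℝ → ℝ) (hφ : IsTest φ),
    ⟪f, (hφ.iteratedDeriv k).toState⟫ = (-1) ^ k * ⟪g, hφ.toState⟫ := by
  simp only [IsTest.inner_toState]
  rfl

lemma IsWeakDeriv.inner_deriv {f g : State} (h : IsWeakDeriv 1 f g) {φ : ℝ → ℝ} (hφ : IsTest φ) :
    ⟪f, hφ.deriv.toState⟫ = -⟪g, hφ.toState⟫ := by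
  have := h φ hφ
  rw [IsTest.inner_toState, IsTest.inner_toState, ← iteratedDeriv_one]
  simpa using this

lemma isWeakDeriv_one {f g : State} (h : ∀ (φ : ℝ → ℝ) (hφ : IsTest φ),
    ⟪f, hφ.deriv.toState⟫ = -⟪g, hφ.toState⟫) : IsWeakDeriv 1 f g := by
  intro φ hφ
  have := h φ hφ
  rw [IsTest.inner_toState, IsTest.inner_toState] at this
  rw [iteratedDeriv_one, this]
  simp

lemma IsWeakDeriv.comp {j k : ℕ} {f g h : State} (h1 : IsWeakDeriv j f g) (h2 : IsWeakDeriv k g h) :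
    IsWeakDeriv (j + k) f h := by
  intro φ hφ
  have e : iteratedDeriv (j + k) φ = iteratedDeriv j (iteratedDeriv k φ) := by
    simp only [iteratedDeriv_eq_iterate, Function.iterate_add_apply]
  rw [e, h1 _ (hφ.iteratedDeriv k), h2 φ hφ, pow_add, mul_assoc]

lemma isWeakDeriv_zero (f : State) : IsWeakDeriv 0 f f := by
  intro φ _
  simp

/-- If `g` and `h` are the weak derivatives of `f` of orders `j` and `j + k`,
then `h` is the weak derivative of `g` of order `k`. -/
lemma IsWeakDeriv.of_comp {j k : ℕ} {f g h : State} (h1 : IsWeakDeriv j f g)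
    (h2 : IsWeakDeriv (j + k) f h) : IsWeakDeriv k g h := by
  intro φ hφ
  have e : iteratedDeriv (j + k) φ = iteratedDeriv j (iteratedDeriv k φ) := by
    simp only [iteratedDeriv_eq_iterate, Function.iterate_add_apply]
  have := h2 φ hφ
  rw [e, h1 _ (hφ.iteratedDeriv k), pow_add, mul_assoc] at this
  exact mul_left_cancel₀ (pow_ne_zero _ (by norm_num)) this

/-- A square integrable function is the weak derivative of its primitive. -/
lemma isWeakDeriv_volterra (g : State) : IsWeakDeriv 1 (volterra g) g := by
  refine isWeakDeriv_one fun φ hφ => ?_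
  rw [IsTest.inner_toState, IsTest.inner_toState]
  have hp : AbsolutelyContinuousOnInterval φ 0 1 :=
    (hφ.smooth.of_le (by simp)).contDiffOn.absolutelyContinuousOnInterval
  have h := (absolutelyContinuous_prim g).integral_mul_deriv_eq_deriv_mul hp
  rw [hφ.apply_one, hφ.apply_zero, mul_zero, mul_zero, sub_zero, zero_sub] at h
  have e1 : ∫ ξ, volterra g ξ * deriv φ ξ ∂unitMeasure = ∫ x in (0 : ℝ)..1, prim g x * deriv φ x := by
    rw [← integral_unit_eq]
    refine integral_congr_ae ?_
    filter_upwards [volterra_coeFn g] with x hx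
    rw [hx]
  have e2 : ∫ ξ, g ξ * φ ξ ∂unitMeasure = ∫ x in (0 : ℝ)..1, deriv (prim g) x * φ x := by
    rw [← integral_unit_eq]
    refine integral_congr_ae ?_
    filter_upwards [ae_restrict_of_ae g.intervalIntegrable.ae_hasDerivAt_integral, ae_mem_unit]
      with x hx hx1
    have := hx (by rw [uIcc_of_le zero_le_one]; exact Ioo_subset_Icc_self hx1) 0 (by simp)
    rw [show deriv (prim g) x = g x from this.deriv]
  rw [e1, e2, h]

/-- A test function with total mass one. -/
lemma exists_isTest_integral_eq_one : ∃ θ : ℝ → ℝ, IsTest θ ∧ ∫ x in (0 : ℝ)..1, θ x = 1 := by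
  let b : ContDiffBump (1 / 2 : ℝ) := ⟨1 / 8, 1 / 4, by norm_num, by norm_num⟩
  refine ⟨b.normed volume, ⟨b.contDiff_normed, b.hasCompactSupport_normed, ?_⟩, ?_⟩
  · rw [b.tsupport_normed_eq, Real.closedBall_eq_Icc]
    intro x hx
    exact ⟨by linarith [hx.1], by linarith [hx.2]⟩
  · refine Eq.trans ?_ (b.integral_normed (μ := volume))
    rw [intervalIntegral.integral_of_le zero_le_one]
    refine setIntegral_eq_integral_of_forall_compl_eq_zero fun x hx => ?_
    apply image_eq_zero_of_notMem_tsupport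
    rw [b.tsupport_normed_eq, Real.closedBall_eq_Icc]
    intro h
    exact hx ⟨by linarith [h.1], by linarith [h.2]⟩

/-- A test function of zero mean is the derivative of a test function. -/
lemma IsTest.exists_eq_deriv {ψ : ℝ → ℝ} (hψ : IsTest ψ) (h : ∫ x in (0 : ℝ)..1, ψ x = 0) :
    ∃ φ, IsTest φ ∧ _root_.deriv φ = ψ := by
  have hd : ∀ x, HasDerivAt (prim ψ) (ψ x) x := fun x =>
    intervalIntegral.integral_hasDerivAt_right (hψ.continuous.intervalIntegrable _ _)
      (hψ.continuous.stronglyMeasurableAtFilter _ _) hψ.continuous.continuousAt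
  have hderiv : _root_.deriv (prim ψ) = ψ := funext fun x => (hd x).deriv
  obtain ⟨a, b, hab, hs⟩ : ∃ a b : ℝ, (0 < a ∧ a < 1 ∧ 0 < b ∧ b < 1) ∧ tsupport ψ ⊆ Icc a b := by
    by_cases he : (tsupport ψ).Nonempty
    · have hc : IsCompact (tsupport ψ) := hψ.compact
      obtain ⟨a, ha, ha'⟩ := hc.exists_isLeast he
      obtain ⟨b, hb, hb'⟩ := hc.exists_isGreatest he
      exact ⟨a, b, ⟨(hψ.supp ha).1, (hψ.supp ha).2, (hψ.supp hb).1, (hψ.supp hb).2⟩,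
        fun x hx => ⟨ha' hx, hb' hx⟩⟩
    · exact ⟨1 / 2, 1 / 2, by norm_num, fun x hx => (he ⟨x, hx⟩).elim⟩
  have hz : ∀ x, x ∉ Icc a b → ψ x = 0 := fun x hx =>
    image_eq_zero_of_notMem_tsupport fun h => hx (hs h)
  -- Left of `a` nothing has been integrated; right of `b` the whole integral has been, and it is
  -- zero.
  have hout : ∀ x, x ∉ Icc a b → prim ψ x = 0 := by
    intro x hx
    rcases not_and_or.1 hx with hx | hx
    · refine intervalIntegral.integral_zero_ae (Filter.Eventually.of_forall fun s hs' => hz s ?_)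
      intro hs2
      have := hs'.2.trans_lt (max_lt hab.1 (not_le.1 hx))
      exact absurd hs2.1 (not_le.2 this)
    · rw [prim, ← intervalIntegral.integral_add_adjacent_intervals
        (hψ.continuous.intervalIntegrable 0 1) (hψ.continuous.intervalIntegrable 1 x), h, zero_add]
      refine intervalIntegral.integral_zero_ae (Filter.Eventually.of_forall fun s hs' => hz s ?_)
      intro hs2
      have := (lt_min hab.2.2.2 (not_le.1 hx)).trans hs'.1
      exact absurd hs2.2 (not_le.2 this)
  have hsub : tsupport (prim ψ) ⊆ Icc a b := by
    refine closure_minimal (fun x hx => ?_) isClosed_Icc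
    by_contra h
    exact hx (hout x h)
  refine ⟨prim ψ, ⟨?_, ?_, ?_⟩, hderiv⟩
  · rw [contDiff_infty_iff_deriv, hderiv]
    exact ⟨fun x => (hd x).differentiableAt, hψ.smooth⟩
  · exact isCompact_Icc.of_isClosed_subset (isClosed_tsupport _) hsub
  · exact hsub.trans fun x hx => ⟨by linarith [hx.1], by linarith [hx.2]⟩

lemma IsTest.toState_eq {φ ψ χ : ℝ → ℝ} (hφ : IsTest φ) (hψ : IsTest ψ) (hχ : IsTest χ) {c : ℝ}
    (h : ∀ x, χ x = c * φ x + ψ x) : hχ.toState = c • hφ.toState + hψ.toState := by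
  rw [toState, toState, toState, ← MemLp.toLp_const_smul, ← MemLp.toLp_add]
  exact MemLp.toLp_congr _ _ (Filter.Eventually.of_forall h)

lemma IsTest.inner_ind {φ : ℝ → ℝ} (hφ : IsTest φ) :
    ⟪ind 0 1, hφ.toState⟫ = ∫ x in (0 : ℝ)..1, φ x := by
  rw [KS.inner_ind _ le_rfl zero_le_one le_rfl]
  exact prim_congr hφ.coeFn_toState (right_mem_Icc.2 zero_le_one)

/-- If the second weak derivative exists, so does the first. -/
lemma IsWeakDeriv.exists_one_of_two {g q : State} (h : IsWeakDeriv 2 g q) :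
    ∃ p, IsWeakDeriv 1 g p := by
  obtain ⟨θ, hθ, hθ1⟩ := exists_isTest_integral_eq_one
  -- The first derivative must be `V q` up to a constant. Every test function is `c θ + φ'` with `φ`
  -- a test function: the identity on `φ'` follows from `g'' = q`, and `κ` is the constant that
  -- makes it true on `θ`.
  set κ := ⟪g, hθ.deriv.toState⟫ + ⟪volterra q, hθ.toState⟫ with hκ
  refine ⟨volterra q - κ • ind 0 1, isWeakDeriv_one fun ψ hψ => ?_⟩
  set c := ∫ x in (0 : ℝ)..1, ψ x with hc
  have hψ' : IsTest (ψ + (-c) • θ) := hψ.add (hθ.const_smul _)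
  obtain ⟨φ, hφ, hφ'⟩ := hψ'.exists_eq_deriv (by
    simp only [Pi.add_apply, Pi.smul_apply, smul_eq_mul]
    rw [intervalIntegral.integral_add (hψ.continuous.intervalIntegrable _ _)
      ((hθ.continuous.intervalIntegrable _ _).const_mul _), intervalIntegral.integral_const_mul,
      hθ1]
    ring)
  have e : ∀ x, ψ x = c * θ x + deriv φ x := fun x => by
    rw [hφ']
    simp
  have e1 : hψ.toState = c • hθ.toState + hφ.deriv.toState := hθ.toState_eq hφ.deriv hψ e
  have e2 : hψ.deriv.toState = c • hθ.deriv.toState + hφ.deriv.deriv.toState := by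
    refine hθ.deriv.toState_eq hφ.deriv.deriv hψ.deriv fun x => ?_
    rw [show ψ = fun x => c * θ x + deriv φ x from funext e]
    exact (((hθ.hasDerivAt x).const_mul c).add (hφ.deriv.hasDerivAt x)).deriv
  have e3 : ⟪g, hφ.deriv.deriv.toState⟫ = ⟪q, hφ.toState⟫ := by
    have := h φ hφ
    rw [IsTest.inner_toState, IsTest.inner_toState, ← iteratedDeriv_one, ← iteratedDeriv_succ']
    rw [iteratedDeriv_succ', iteratedDeriv_one] at this
    simpa [iteratedDeriv_succ', iteratedDeriv_one] using this
  have e4 := (isWeakDeriv_volterra q).inner_deriv hφ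
  rw [inner_sub_left, real_inner_smul_left, hψ.inner_ind, ← hc, e2, inner_add_right,
    real_inner_smul_right, e3, e1, inner_add_right, real_inner_smul_right, e4, hκ]
  ring

lemma IsTest.toState_eq_zero {φ : ℝ → ℝ} (hφ : IsTest φ) (h : ∀ x, φ x = 0) : hφ.toState = 0 := by
  have := hφ.toState_eq hφ hφ (c := -1) (fun x => by simp [h x])
  rwa [neg_one_smul, neg_add_cancel] at this

/-! ### The space `H²₀` described by second derivatives -/

/-- The second derivatives of test functions. -/
def testSecondDeriv : Submodule ℝ State where
  carrier := {f | ∃ (φ : ℝ → ℝ) (hφ : IsTest φ), f = hφ.deriv.deriv.toState}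
  zero_mem' := ⟨0, IsTest.zero, (IsTest.zero.deriv.deriv.toState_eq_zero fun x => by
    rw [Pi.zero_def, deriv_const', deriv_const]).symm⟩
  add_mem' := by
    rintro _ _ ⟨φ, hφ, rfl⟩ ⟨ψ, hψ, rfl⟩
    have e : deriv (φ + ψ) = deriv φ + deriv ψ :=
      funext fun x => ((hφ.hasDerivAt x).add (hψ.hasDerivAt x)).deriv
    refine ⟨φ + ψ, hφ.add hψ, ?_⟩
    rw [hφ.deriv.deriv.toState_eq hψ.deriv.deriv (hφ.add hψ).deriv.deriv (c := 1), one_smul]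
    intro x
    rw [e, one_mul]
    exact ((hφ.deriv.hasDerivAt x).add (hψ.deriv.hasDerivAt x)).deriv
  smul_mem' := by
    rintro c _ ⟨φ, hφ, rfl⟩
    have e : deriv (c • φ) = c • deriv φ :=
      funext fun x => ((hφ.hasDerivAt x).const_smul c).deriv
    refine ⟨c • φ, hφ.const_smul c, ?_⟩
    rw [hφ.deriv.deriv.toState_eq IsTest.zero (hφ.const_smul c).deriv.deriv (c := c),
      IsTest.zero.toState_eq_zero (fun _ => rfl), add_zero]
    intro x
    rw [e, Pi.zero_apply, add_zero]
    exact ((hφ.deriv.hasDerivAt x).const_smul c).deriv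

/-- The second derivatives of functions in `H²₀(0,1)`. -/
def clamped : Submodule ℝ State := testSecondDeriv.topologicalClosure

instance : CompleteSpace clamped :=
  testSecondDeriv.isClosed_topologicalClosure.completeSpace_coe

lemma IsTest.mem_clamped {φ : ℝ → ℝ} (hφ : IsTest φ) : hφ.deriv.deriv.toState ∈ clamped :=
  testSecondDeriv.le_topologicalClosure ⟨φ, hφ, rfl⟩

lemma clamped_induction {P : State → Prop} (hc : IsClosed {g | P g})
    (h : ∀ (φ : ℝ → ℝ) (hφ : IsTest φ), P hφ.deriv.deriv.toState) {g : State} (hg : g ∈ clamped) :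
    P g := by
  have : closure (testSecondDeriv : Set State) ⊆ {g | P g} :=
    closure_minimal (by rintro _ ⟨φ, hφ, rfl⟩; exact h φ hφ) hc
  exact this hg

lemma IsTest.norm_toState_sq {φ : ℝ → ℝ} (hφ : IsTest φ) :
    ‖hφ.toState‖ ^ 2 = ∫ x in (0 : ℝ)..1, φ x ^ 2 := by
  rw [← real_inner_self_eq_norm_sq, hφ.inner_toState, ← integral_unit_eq]
  refine integral_congr_ae ?_
  filter_upwards [hφ.coeFn_toState] with x hx
  rw [hx, sq]

/-- For `g = φ''` one has `V g = φ'`, which vanishes at both ends and has mean `φ 1 - φ 0 = 0`;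
density gives the rest. -/
lemma wirtinger_clamped {g : State} (hg : g ∈ clamped) :
    4 * Real.pi ^ 2 * ‖volterra g‖ ^ 2 ≤ ‖g‖ ^ 2 := by
  refine clamped_induction (P := fun g => 4 * Real.pi ^ 2 * ‖volterra g‖ ^ 2 ≤ ‖g‖ ^ 2)
    (isClosed_le (by fun_prop) (by fun_prop)) (fun φ hφ => ?_) hg
  rw [hφ.deriv.volterra_deriv, IsTest.norm_toState_sq, IsTest.norm_toState_sq]
  refine wirtinger hφ.deriv.hasDerivAt hφ.deriv.deriv.continuous ?_ ?_
  · rw [hφ.deriv.apply_zero, hφ.deriv.apply_one]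
  · have := hφ.prim_deriv 1
    rwa [hφ.apply_one] at this

lemma norm_volterra_le (g : State) : ‖volterra g‖ ≤ ‖g‖ := by
  have h : ‖volterra‖ ≤ 1 := LinearMap.mkContinuous_norm_le _ zero_le_one _
  exact (volterra.le_of_opNorm_le h g).trans_eq (one_mul _)

lemma isWeakDeriv_two_volterra (g : State) : IsWeakDeriv 2 (volterra (volterra g)) g :=
  (isWeakDeriv_volterra _).comp (isWeakDeriv_volterra g)

lemma eLpNorm_sub_lt_iff {φ : ℝ → ℝ} (hφ : IsTest φ) (f : State) {ε : ℝ} :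
    eLpNorm (fun ξ => f ξ - φ ξ) 2 unitMeasure < ENNReal.ofReal ε ↔ ‖f - hφ.toState‖ < ε := by
  have e : eLpNorm (fun ξ => f ξ - φ ξ) 2 unitMeasure
      = eLpNorm (f - hφ.toState : State) 2 unitMeasure := by
    refine eLpNorm_congr_ae ?_
    filter_upwards [hφ.coeFn_toState, Lp.coeFn_sub f hφ.toState] with x h1 h2
    rw [h2, Pi.sub_apply, h1]
  rw [e, ENNReal.lt_ofReal_iff_toReal_lt (Lp.eLpNorm_ne_top _), Lp.norm_def]

lemma iteratedDeriv_two (φ : ℝ → ℝ) : iteratedDeriv 2 φ = deriv (deriv φ) := by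
  rw [iteratedDeriv_succ, iteratedDeriv_one]

/-- `V` has norm at most one, so approximating `g` by `φ''` also approximates `V g` by `φ'` and `V
(V g)` by `φ`. -/
lemma volterra_mem_sobolevZero {g : State} (hg : g ∈ clamped) :
    volterra (volterra g) ∈ sobolevZero 2 := by
  have h1 := isWeakDeriv_volterra (volterra g)
  have h2 := isWeakDeriv_two_volterra g
  have h0 := isWeakDeriv_zero (volterra (volterra g))
  refine ⟨fun j hj => ?_, fun ε hε => ?_⟩
  · interval_cases j
    exacts [⟨_, h0⟩, ⟨_, h1⟩, ⟨_, h2⟩]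
  · obtain ⟨_, ⟨φ, hφ, rfl⟩, hlt⟩ := Metric.mem_closure_iff.1 hg ε hε
    rw [dist_eq_norm] at hlt
    have hlt1 : ‖volterra g - hφ.deriv.toState‖ < ε := by
      rw [← hφ.deriv.volterra_deriv, ← map_sub]
      exact (norm_volterra_le _).trans_lt hlt
    refine ⟨φ, hφ, fun j hj => ?_⟩
    interval_cases j
    · rw [h0.weakDeriv_eq, iteratedDeriv_zero, eLpNorm_sub_lt_iff hφ, ← hφ.volterra_deriv,
        ← map_sub]
      exact (norm_volterra_le _).trans_lt hlt1
    · rwa [h1.weakDeriv_eq, iteratedDeriv_one, eLpNorm_sub_lt_iff hφ.deriv]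
    · rwa [h2.weakDeriv_eq, iteratedDeriv_two, eLpNorm_sub_lt_iff hφ.deriv.deriv]

/-- If `φₙ → w` and `φₙ'' → w''`, continuity of `V` lets `φₙ = V (V φₙ'')` pass to the limit; the
first derivatives play no role. -/
lemma exists_clamped_of_sobolevZero {w : State} (hw : w ∈ sobolevZero 2) :
    ∃ g ∈ clamped, w = volterra (volterra g) := by
  have H : ∀ n : ℕ, ∃ (φ : ℝ → ℝ) (hφ : IsTest φ), ‖w - hφ.toState‖ < 1 / (n + 1) ∧
      ‖weakDeriv 2 w - hφ.deriv.deriv.toState‖ < 1 / (n + 1) := fun n => by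
    obtain ⟨φ, hφ, h⟩ := hw.2 (1 / (n + 1)) (by positivity)
    have h0 := h 0 (by norm_num)
    have h2 := h 2 le_rfl
    rw [(isWeakDeriv_zero w).weakDeriv_eq, iteratedDeriv_zero, eLpNorm_sub_lt_iff hφ] at h0
    rw [iteratedDeriv_two, eLpNorm_sub_lt_iff hφ.deriv.deriv] at h2
    exact ⟨φ, hφ, h0, h2⟩
  choose φ hφ h0 h2 using H
  have t0 : Filter.Tendsto (fun n => (hφ n).toState) Filter.atTop (𝓝 w) := by
    rw [tendsto_iff_norm_sub_tendsto_zero]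
    refine squeeze_zero (fun n => norm_nonneg _) (fun n => ?_) tendsto_one_div_add_atTop_nhds_zero_nat
    rw [norm_sub_rev]
    exact (h0 n).le
  have t2 : Filter.Tendsto (fun n => (hφ n).deriv.deriv.toState) Filter.atTop
      (𝓝 (weakDeriv 2 w)) := by
    rw [tendsto_iff_norm_sub_tendsto_zero]
    refine squeeze_zero (fun n => norm_nonneg _) (fun n => ?_) tendsto_one_div_add_atTop_nhds_zero_nat
    rw [norm_sub_rev]
    exact (h2 n).le
  refine ⟨weakDeriv 2 w, ?_, ?_⟩
  · exact testSecondDeriv.isClosed_topologicalClosure.mem_of_tendsto t2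
      (Filter.Eventually.of_forall fun n => (hφ n).mem_clamped)
  · have t := ((volterra.continuous.comp volterra.continuous).tendsto _).comp t2
    refine tendsto_nhds_unique t0 (t.congr fun n => ?_)
    change volterra (volterra (hφ n).deriv.deriv.toState) = _
    rw [(hφ n).deriv.volterra_deriv, (hφ n).volterra_deriv]

/-! ### The operator, its quadratic form and its least eigenvalue -/

/-- Weak solutions of `w'''' + lam w'' = f` in `H²₀` belong to the domain of the operator. -/
theorem mem_domainA_of_form {lam : ℝ} {g f : State} (hg : g ∈ clamped)
    (h : ∀ k ∈ clamped, ⟪g, k⟫ - lam * ⟪volterra g, volterra k⟫ = ⟪f, volterra (volterra k)⟫) :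
    volterra (volterra g) ∈ domainA ∧ -opA lam (volterra (volterra g)) = f := by
  have h1 := isWeakDeriv_volterra (volterra g)
  have h2 := isWeakDeriv_two_volterra g
  -- Testing with `k = φ''` and moving one derivative in `⟪V g, φ'⟫` reads `⟪g, φ''⟫ = ⟪f - lam g,
  -- φ⟫`.
  have hgg : IsWeakDeriv 2 g (f - lam • g) := by
    rw [isWeakDeriv_iff]
    intro φ hφ
    have := h _ hφ.mem_clamped
    rw [hφ.deriv.volterra_deriv, hφ.volterra_deriv,
      (isWeakDeriv_volterra g).inner_deriv hφ] at this
    have e : (hφ.iteratedDeriv 2).toState = hφ.deriv.deriv.toState :=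
      MemLp.toLp_congr _ _ (by rw [iteratedDeriv_two])
    rw [e, inner_sub_left, real_inner_smul_left]
    linarith
  have h4 : IsWeakDeriv 4 (volterra (volterra g)) (f - lam • g) := h2.comp hgg
  -- Membership in `H⁴` also asks for the third derivative of `V (V g)`, which is `g'`.
  obtain ⟨p, hp⟩ := hgg.exists_one_of_two
  refine ⟨⟨fun j hj => ?_, volterra_mem_sobolevZero hg⟩, ?_⟩
  · interval_cases j
    exacts [⟨_, isWeakDeriv_zero _⟩, ⟨_, h1⟩, ⟨_, h2⟩, ⟨_, h2.comp hp⟩, ⟨_, h4⟩]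
  · rw [opA, h4.weakDeriv_eq, h2.weakDeriv_eq]
    abel

/-- Elements of the domain of the operator satisfy the weak form of the equation. -/
theorem form_of_mem_domainA (lam : ℝ) {w : State} (hw : w ∈ domainA) :
    ∃ g ∈ clamped, w = volterra (volterra g) ∧ ∀ k ∈ clamped,
      ⟪g, k⟫ - lam * ⟪volterra g, volterra k⟫ = ⟪-opA lam w, volterra (volterra k)⟫ := by
  obtain ⟨g, hg, rfl⟩ := exists_clamped_of_sobolevZero hw.2
  refine ⟨g, hg, rfl, fun k hk => ?_⟩
  have h2 := isWeakDeriv_two_volterra g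
  obtain ⟨q, h4⟩ := hw.1 4 le_rfl
  have hq : IsWeakDeriv 2 g q := h2.of_comp h4
  refine clamped_induction (P := fun k => ⟪g, k⟫ - lam * ⟪volterra g, volterra k⟫ =
    ⟪-opA lam (volterra (volterra g)), volterra (volterra k)⟫)
    (isClosed_eq (by fun_prop) (by fun_prop)) (fun φ hφ => ?_) hk
  rw [hφ.deriv.volterra_deriv, hφ.volterra_deriv, (isWeakDeriv_volterra g).inner_deriv hφ,
    opA, h4.weakDeriv_eq, h2.weakDeriv_eq]
  have e : (hφ.iteratedDeriv 2).toState = hφ.deriv.deriv.toState :=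
    MemLp.toLp_congr _ _ (by rw [iteratedDeriv_two])
  have := isWeakDeriv_iff.1 hq φ hφ
  rw [e] at this
  rw [this, inner_neg_left, inner_sub_left, inner_neg_left, real_inner_smul_left]
  ring

/-- The energy form on `clamped`. -/
def energyForm (lam : ℝ) : clamped →L[ℝ] clamped →L[ℝ] ℝ :=
  LinearMap.mkContinuous₂
    (LinearMap.mk₂ ℝ (fun g k : clamped =>
      ⟪(g : State), (k : State)⟫ - lam * ⟪volterra g, volterra k⟫)
      (fun g g' k => by simp only [Submodule.coe_add, map_add, inner_add_left]; ring)
      (fun c g k => by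
        simp only [Submodule.coe_smul, map_smul, real_inner_smul_left, smul_eq_mul]; ring)
      (fun g k k' => by simp only [Submodule.coe_add, map_add, inner_add_right]; ring)
      (fun c g k => by
        simp only [Submodule.coe_smul, map_smul, real_inner_smul_right, smul_eq_mul]; ring))
    (1 + |lam|) (fun g k => by
      rw [LinearMap.mk₂_apply, Real.norm_eq_abs]
      refine (abs_sub _ _).trans ?_
      have h1 := abs_real_inner_le_norm (g : State) (k : State)
      have h2 : |⟪volterra g, volterra k⟫| ≤ ‖(g : State)‖ * ‖(k : State)‖ :=
        (abs_real_inner_le_norm _ _).trans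
          (mul_le_mul (norm_volterra_le _) (norm_volterra_le _) (norm_nonneg _) (norm_nonneg _))
      have h3 := mul_le_mul_of_nonneg_left h2 (abs_nonneg lam)
      rw [abs_mul, Submodule.coe_norm, Submodule.coe_norm]
      linarith)

lemma energyForm_apply (lam : ℝ) (g k : clamped) : energyForm lam g k =
    ⟪(g : State), (k : State)⟫ - lam * ⟪volterra g, volterra k⟫ := rfl

/-- For `lam ≥ 0` Wirtinger leaves the factor `1 - lam / (4π²)`; for `lam ≤ 0` the second term only
helps and the factor is `1`. -/
lemma isCoercive_energyForm {lam : ℝ} (hlam : lam < 4 * Real.pi ^ 2) :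
    IsCoercive (energyForm lam) := by
  have hpi : 0 < 4 * Real.pi ^ 2 := by have := Real.pi_pos; positivity
  have hc : 0 < min 1 (1 - lam / (4 * Real.pi ^ 2)) :=
    lt_min one_pos (sub_pos.2 ((div_lt_one hpi).2 hlam))
  refine ⟨_, hc, fun g => ?_⟩
  have hw := wirtinger_clamped g.2
  rw [energyForm_apply, real_inner_self_eq_norm_sq, real_inner_self_eq_norm_sq, mul_assoc, ← sq]
  change _ * ‖(g : State)‖ ^ 2 ≤ _
  have hn := sq_nonneg ‖(g : State)‖
  rcases le_total lam 0 with h | h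
  · have h1 : min 1 (1 - lam / (4 * Real.pi ^ 2)) * ‖(g : State)‖ ^ 2 ≤ 1 * ‖(g : State)‖ ^ 2 :=
      mul_le_mul_of_nonneg_right (min_le_left _ _) hn
    nlinarith [sq_nonneg ‖volterra g‖]
  · have h1 : min 1 (1 - lam / (4 * Real.pi ^ 2)) * ‖(g : State)‖ ^ 2 ≤
        (1 - lam / (4 * Real.pi ^ 2)) * ‖(g : State)‖ ^ 2 :=
      mul_le_mul_of_nonneg_right (min_le_right _ _) hn
    have h2 := mul_le_mul_of_nonneg_left hw (div_nonneg h hpi.le)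
    have h3 : lam / (4 * Real.pi ^ 2) * (4 * Real.pi ^ 2 * ‖volterra g‖ ^ 2)
        = lam * ‖volterra g‖ ^ 2 := by field_simp
    rw [h3] at h2
    linarith

/-- The embedding of `H²₀(0,1)` into the state space, in terms of the second derivative. -/
def clampedEmbedding : clamped →L[ℝ] State := volterra ∘L volterra ∘L clamped.subtypeL

lemma clampedEmbedding_ne_zero : clampedEmbedding ≠ 0 := by
  intro h
  obtain ⟨θ, hθ, hθ1⟩ := exists_isTest_integral_eq_one
  have h1 : clampedEmbedding ⟨_, hθ.mem_clamped⟩ = hθ.toState := by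
    change volterra (volterra hθ.deriv.deriv.toState) = _
    rw [hθ.deriv.volterra_deriv, hθ.volterra_deriv]
  rw [h, zero_apply] at h1
  rw [← hθ.inner_ind, ← h1, inner_zero_right] at hθ1
  exact zero_ne_one hθ1

theorem isLeast_sigma {lam : ℝ} (hlam : lam < 4 * Real.pi ^ 2) :
    IsLeast (eigenvaluesNegA lam) (sigma lam) ∧ 0 < sigma lam ∧
      ∀ w ∈ domainA, sigma lam * ‖w‖ ^ 2 ≤ ⟪-opA lam w, w⟫ := by
  obtain ⟨σ, hσ, hle, g, hg0, hg⟩ := exists_least_rayleigh clampedEmbedding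
    (isCompactOperator_volterra.comp_clm (volterra ∘L clamped.subtypeL)) clampedEmbedding_ne_zero
    (energyForm lam) (isCoercive_energyForm hlam) (fun x y => by
      rw [energyForm_apply, energyForm_apply, real_inner_comm, real_inner_comm (volterra x)])
  have hge : ∀ w ∈ domainA, σ * ‖w‖ ^ 2 ≤ ⟪-opA lam w, w⟫ := fun w hw => by
    obtain ⟨k, hk, rfl, h⟩ := form_of_mem_domainA lam hw
    have := hle ⟨k, hk⟩
    rw [energyForm_apply, h k hk] at this
    exact this
  -- The minimizer solves the weak eigenvalue equation, so regularity puts it in the domain; the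
  -- lower bound `hge`, applied to any eigenvector, shows that no eigenvalue is smaller.
  have hL : IsLeast (eigenvaluesNegA lam) σ := by
    constructor
    · obtain ⟨h1, h2⟩ := mem_domainA_of_form (lam := lam) (f := σ • clampedEmbedding g) g.2
        (fun k hk => by
          rw [real_inner_smul_left]
          exact hg ⟨k, hk⟩)
      exact ⟨clampedEmbedding g, h1, hg0, h2⟩
    · rintro μ ⟨w, hw, hw0, hμ⟩
      have := hge w hw
      rw [hμ, real_inner_smul_left, real_inner_self_eq_norm_sq] at this
      exact le_of_mul_le_mul_right this (by have := norm_pos_iff.2 hw0; positivity)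
  have e : sigma lam = σ := hL.csInf_eq
  rw [e]
  exact ⟨hL, hσ, hge⟩

/-! ### Energy balance of strict solutions -/

/-- The nonlinearity does not contribute to the energy balance. -/
lemma nonlinF_energy {w : State} (hw : w ∈ sobolevZero 2) :
    Integrable (fun ξ => nonlinF w ξ * w ξ) unitMeasure ∧
      ∫ ξ, nonlinF w ξ * w ξ ∂unitMeasure = 0 := by
  obtain ⟨g, hg, rfl⟩ := exists_clamped_of_sobolevZero hw
  set p := prim g with hp
  set q := prim p with hq
  have hpc : ContinuousOn p (Icc 0 1) := continuousOn_prim g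
  have hqe : ∀ x ∈ Icc (0 : ℝ) 1, prim (volterra g) x = q x := fun x hx =>
    prim_congr (volterra_coeFn g) hx
  have hqc : ContinuousOn q (Icc 0 1) :=
    (continuousOn_prim (volterra g)).congr fun x hx => (hqe x hx).symm
  have hq0 : q 0 = 0 := intervalIntegral.integral_same
  -- This is the boundary condition `w(1) = 0`, a closed condition on `g` that holds for test
  -- functions.
  have hq1 : q 1 = 0 := by
    rw [← hqe 1 (right_mem_Icc.2 zero_le_one), prim, ← inner_ind _ le_rfl zero_le_one le_rfl]
    refine clamped_induction (P := fun g => ⟪ind 0 1, volterra g⟫ = 0)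
      (isClosed_eq (by fun_prop) (by fun_prop)) (fun φ hφ => ?_) hg
    rw [hφ.deriv.volterra_deriv, hφ.deriv.inner_ind]
    have := hφ.prim_deriv 1
    rwa [hφ.apply_one] at this
  have hae : (fun ξ => nonlinF (volterra (volterra g)) ξ * volterra (volterra g) ξ)
      =ᵐ[unitMeasure] fun x => -(q x ^ 2 * p x) := by
    filter_upwards [volterra_coeFn (volterra g), volterra_coeFn g, ae_mem_unit] with x h1 h2 hx
    rw [nonlinF, (isWeakDeriv_volterra (volterra g)).weakDeriv_eq, h1, h2,
      hqe x (Ioo_subset_Icc_self hx)]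
    ring
  have hcont : ContinuousOn (fun x => -(q x ^ 2 * p x)) (Icc 0 1) := ((hqc.pow 2).mul hpc).neg
  refine ⟨((memLp_unit_of_continuousOn hcont).integrable one_le_two).congr hae.symm, ?_⟩
  rw [integral_congr_ae hae, integral_unit_eq,
    intervalIntegral.integral_eq_sub_of_hasDerivAt_of_le zero_le_one
      (f := fun x => -(q x ^ 3 / 3)) ((hqc.pow 3).div_const 3).neg (fun x hx => ?_)
      (hcont.intervalIntegrable_of_Icc zero_le_one), hq0, hq1]
  · simp
  · have hd : HasDerivAt q (p x) x :=
      intervalIntegral.integral_hasDerivAt_right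
        ((hpc.mono (Icc_subset_Icc_right hx.2.le)).intervalIntegrable_of_Icc hx.1.le)
        ((hpc.mono Ioo_subset_Icc_self).stronglyMeasurableAtFilter isOpen_Ioo x hx)
        (hpc.continuousAt (Icc_mem_nhds hx.1 hx.2))
    refine ((hd.pow 3).div_const 3).neg.congr_deriv ?_
    push_cast
    ring

/-- Absolute continuity passes to any function whose increments are dominated; it is applied to
`‖W‖²` against the primitive of `‖v‖`. -/
lemma absolutelyContinuousOnInterval_of_dist_le {X Y : Type*} [PseudoMetricSpace X]
    [PseudoMetricSpace Y] {f : ℝ → X} {G : ℝ → Y} {a b C : ℝ}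
    (hG : AbsolutelyContinuousOnInterval G a b)
    (h : ∀ s ∈ uIcc a b, ∀ t ∈ uIcc a b, dist (f s) (f t) ≤ C * dist (G s) (G t)) :
    AbsolutelyContinuousOnInterval f a b := by
  unfold AbsolutelyContinuousOnInterval at hG ⊢
  refine squeeze_zero' (Filter.Eventually.of_forall fun _ => Finset.sum_nonneg fun _ _ =>
    dist_nonneg) ?_ (by simpa using hG.const_mul C)
  rw [Filter.eventually_inf_principal]
  filter_upwards with E hE
  rw [Finset.mul_sum]
  exact Finset.sum_le_sum fun i hi => h _ (hE.1 i hi).1 _ (hE.1 i hi).2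

/-- The energy identity for the primitive of an integrable function. -/
theorem norm_sq_primitive {E : Type*} [NormedAddCommGroup E] [InnerProductSpace ℝ E]
    [CompleteSpace E] {τ : ℝ} (hτ : 0 ≤ τ) {v : ℝ → E} (hv : IntervalIntegrable v volume 0 τ)
    {w : ℝ → E} (hw : ∀ t ∈ Icc 0 τ, w t = w 0 + ∫ s in (0 : ℝ)..t, v s) :
    IntervalIntegrable (fun t => ⟪w t, v t⟫) volume 0 τ ∧
      ‖w τ‖ ^ 2 = ‖w 0‖ ^ 2 + ∫ t in (0 : ℝ)..τ, 2 * ⟪w t, v t⟫ := by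
  -- `w` is prescribed only on `[0, τ]`; `W` extends it by the formula, so that two-sided
  -- derivatives make sense.
  let W : ℝ → E := fun t => w 0 + ∫ s in (0 : ℝ)..t, v s
  have hWw : ∀ t ∈ Icc 0 τ, w t = W t := hw
  have hWc : ContinuousOn W (uIcc 0 τ) := continuousOn_const.add
    (intervalIntegral.continuousOn_primitive_interval' hv (by simp))
  obtain ⟨D, hD⟩ := isCompact_uIcc.exists_bound_of_continuousOn hWc
  have hint : IntervalIntegrable (fun t => ⟪W t, v t⟫) volume 0 τ := by
    rw [intervalIntegrable_iff] at hv ⊢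
    refine Integrable.mono' (hv.norm.const_mul D) (AEStronglyMeasurable.inner
      ((hWc.mono uIoc_subset_uIcc).aestronglyMeasurable measurableSet_uIoc)
      hv.aestronglyMeasurable) ?_
    filter_upwards [ae_restrict_mem measurableSet_uIoc] with t ht
    refine (norm_inner_le_norm _ _).trans ?_
    gcongr
    exact hD t (uIoc_subset_uIcc ht)
  have hF : AbsolutelyContinuousOnInterval (fun t => ‖W t‖ ^ 2) 0 τ := by
    refine absolutelyContinuousOnInterval_of_dist_le (C := 2 * D)
      (hv.norm.absolutelyContinuousOnInterval_intervalIntegral (c := 0) (by simp))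
      fun s hs t ht => ?_
    have hvs : IntervalIntegrable v volume 0 s := hv.mono_set (uIcc_subset_uIcc (by simp) hs)
    have hvt : IntervalIntegrable v volume 0 t := hv.mono_set (uIcc_subset_uIcc (by simp) ht)
    have h1 : ‖W s - W t‖ ≤ |∫ x in t..s, ‖v x‖| := by
      have e : W s - W t = ∫ x in t..s, v x := by
        simp only [W, add_sub_add_left_eq_sub]
        exact intervalIntegral.integral_interval_sub_left hvs hvt
      rw [e]
      exact intervalIntegral.norm_integral_le_abs_integral_norm
    rw [Real.dist_eq, Real.dist_eq,
      intervalIntegral.integral_interval_sub_left hvs.norm hvt.norm, sq_sub_sq, abs_mul]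
    refine mul_le_mul ?_ ((abs_norm_sub_norm_le _ _).trans h1) (abs_nonneg _) ?_
    · rw [abs_of_nonneg (by positivity)]
      linarith [hD s hs, hD t ht]
    · linarith [hD s hs, norm_nonneg (W s)]
  have hd : ∀ᵐ t, t ∈ uIcc 0 τ → HasDerivAt (fun t => ‖W t‖ ^ 2) (2 * ⟪W t, v t⟫) t := by
    filter_upwards [hv.ae_hasDerivAt_integral] with t ht h
    exact ((ht h 0 (by simp)).const_add (w 0)).norm_sq
  have hkey := hF.integral_deriv_eq_sub
  have hW0 : W 0 = w 0 := by simp [W]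
  rw [hW0, ← hWw τ (right_mem_Icc.2 hτ)] at hkey
  refine ⟨(intervalIntegrable_congr fun t ht => ?_).1 hint, ?_⟩
  · have h' := uIoc_subset_uIcc ht
    rw [uIcc_of_le hτ] at h'
    simp only [hWw t h']
  · have : ∫ t in (0 : ℝ)..τ, 2 * ⟪w t, v t⟫ = ∫ t in (0 : ℝ)..τ, deriv (fun t => ‖W t‖ ^ 2) t := by
      refine intervalIntegral.integral_congr_ae ?_
      filter_upwards [hd] with t ht h
      have h' := uIoc_subset_uIcc h
      rw [(ht h').deriv, hWw t (by rwa [uIcc_of_le hτ] at h')]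
    linarith

lemma norm_sq_eq_integral {μ : Measure ℝ} (f : Lp ℝ 2 μ) : ‖f‖ ^ 2 = ∫ x, f x ^ 2 ∂μ := by
  rw [← real_inner_self_eq_norm_sq, L2.inner_def]
  simp [sq]

lemma integrable_sq {μ : Measure ℝ} (f : Lp ℝ 2 μ) : Integrable (fun x => f x ^ 2) μ :=
  (memLp_two_iff_integrable_sq (Lp.aestronglyMeasurable f)).1 (Lp.memLp f)

/-- The `L²` norm of a continuous function is bounded by its maximum. -/
lemma norm_toLp_sq_le {β : ℝ → ℝ} (hβ : ContinuousOn β (Icc 0 1)) :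
    ‖((memLp_unit_of_continuousOn hβ).toLp : State)‖ ^ 2 ≤
      sSup ((fun ξ => β ξ ^ 2) '' Icc (0 : ℝ) 1) := by
  have hbdd : BddAbove ((fun ξ => β ξ ^ 2) '' Icc (0 : ℝ) 1) :=
    (isCompact_Icc.image_of_continuousOn (hβ.pow 2)).bddAbove
  set f : State := (memLp_unit_of_continuousOn hβ).toLp with hf
  have h : ∫ x, f x ^ 2 ∂unitMeasure ≤
      ∫ _, sSup ((fun ξ => β ξ ^ 2) '' Icc (0 : ℝ) 1) ∂unitMeasure := by
    refine integral_mono_ae (integrable_sq f) (integrable_const _) ?_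
    filter_upwards [(memLp_unit_of_continuousOn hβ).coeFn_toLp, ae_mem_unit] with x hx hx1
    rw [hf, hx]
    exact le_csSup hbdd ⟨x, Ioo_subset_Icc_self hx1, rfl⟩
  rw [norm_sq_eq_integral]
  simpa [Measure.real] using h

/-- The pointwise energy balance of the controlled equation. -/
lemma energy_balance {lam c : ℝ} {w v β : State} (hw : w ∈ domainA)
    (h : ∀ᵐ ξ ∂unitMeasure, v ξ = opA lam w ξ + nonlinF w ξ + β ξ * c) :
    ⟪w, v⟫ = -⟪-opA lam w, w⟫ + c * ⟪w, β⟫ := by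
  obtain ⟨hi, h0⟩ := nonlinF_energy hw.2
  -- The equation itself shows that the nonlinear term is square integrable, so its pairing with `w`
  -- is an inner product in the state space.
  have e : ∀ᵐ ξ ∂unitMeasure, (v - opA lam w - c • β : State) ξ = nonlinF w ξ := by
    filter_upwards [h, Lp.coeFn_sub (v - opA lam w) (c • β), Lp.coeFn_sub v (opA lam w),
      Lp.coeFn_smul c β] with ξ h1 h2 h3 h4
    rw [h2, Pi.sub_apply, h3, Pi.sub_apply, h4, h1, Pi.smul_apply, smul_eq_mul]
    ring
  have h1 : ⟪v - opA lam w - c • β, w⟫ = 0 := by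
    rw [inner_eq_integral, ← h0]
    refine integral_congr_ae ?_
    filter_upwards [e] with ξ hξ
    rw [hξ]
  rw [inner_sub_left, inner_sub_left, real_inner_smul_left, real_inner_comm, real_inner_comm w β]
    at h1
  rw [inner_neg_left]
  linarith

end KS

end

/-! ### The dissipation estimate -/

theorem mainTheorem10 (lam : ℝ) (hlam : lam < 4 * Real.pi ^ 2) :
    IsLeast (KS.eigenvaluesNegA lam) (KS.sigma lam) ∧ 0 < KS.sigma lam ∧
    ∀ (b : ℝ → ℝ → ℝ)
      (_hb : ∀ r ∈ Set.Ioo (0 : ℝ) 1, ContDiffOn ℝ 1 (fun ξ => b ξ r) (Set.Icc 0 1))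
      (r : ℝ) (_hr : r ∈ Set.Ioo (0 : ℝ) 1) (τ : ℝ) (_hτ : 0 < τ)
      (w₀ : KS.State) (_hw₀ : w₀ ∈ KS.sobolevZero 1)
      (u : MeasureTheory.Lp ℝ 2 (MeasureTheory.volume.restrict (Set.Ioo (0 : ℝ) τ)))
      (w : ℝ → KS.State)
      (_hw : KS.IsStrictSolution lam τ (fun ξ => b ξ r) u w₀ w),
      ‖w τ‖ ^ 2 ≤ ‖w₀‖ ^ 2 +
        1 / KS.sigma lam * ‖u‖ ^ 2 * sSup ((fun ξ => b ξ r ^ 2) '' Set.Icc (0 : ℝ) 1) := by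
  obtain ⟨hL, hσ, hge⟩ := KS.isLeast_sigma hlam
  refine ⟨hL, hσ, ?_⟩
  rintro b hb r hr τ hτ w₀ - u w ⟨rfl, hdom, v, hv, heq⟩
  have hβ : ContinuousOn (fun ξ => b ξ r) (Icc 0 1) := (hb r hr).continuousOn
  set β : KS.State := (KS.memLp_unit_of_continuousOn hβ).toLp with hβdef
  set B := sSup ((fun ξ => b ξ r ^ 2) '' Icc (0 : ℝ) 1) with hB
  have hβB : ‖β‖ ^ 2 ≤ B := KS.norm_toLp_sq_le hβ
  have hvi : IntervalIntegrable v volume 0 τ := by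
    rw [intervalIntegrable_iff_integrableOn_Ioo_of_le hτ.le]
    exact hv.memLp.integrable one_le_two
  obtain ⟨hi, hE⟩ := KS.norm_sq_primitive hτ.le hvi hv.primitive
  rw [hE, intervalIntegral.integral_of_le hτ.le, integral_Ioc_eq_integral_Ioo, add_le_add_iff_left,
    KS.norm_sq_eq_integral, mul_right_comm, ← integral_const_mul]
  refine integral_mono_ae ?_ ((KS.integrable_sq u).const_mul _) ?_
  · rw [intervalIntegrable_iff_integrableOn_Ioo_of_le hτ.le] at hi
    exact hi.const_mul 2
  filter_upwards [heq, hdom.mem] with t ht hwt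
  have h1 := KS.energy_balance (β := β) (c := u t) hwt (by
    filter_upwards [ht, (KS.memLp_unit_of_continuousOn hβ).coeFn_toLp] with ξ h1 h2
    rw [h1, hβdef, h2])
  have h2 := hge _ hwt
  have h3 : u t * inner ℝ (w t) β ≤ |u t| * (‖w t‖ * ‖β‖) := by
    refine (le_abs_self _).trans ?_
    rw [abs_mul]
    exact mul_le_mul_of_nonneg_left (abs_real_inner_le_norm _ _) (abs_nonneg _)
  have h4 : u t ^ 2 * ‖β‖ ^ 2 ≤ u t ^ 2 * B := mul_le_mul_of_nonneg_left hβB (sq_nonneg _)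
  set σ := KS.sigma lam
  have h5 : 1 / σ * B * u t ^ 2 = (u t ^ 2 * B) / σ := by ring
  rw [h5, le_div_iff₀ hσ, h1]
  -- Young's inequality: `2σ ‖w‖ |u| ‖β‖ ≤ σ² ‖w‖² + u² ‖β‖²`. This uses half of the dissipation
  -- `2σ² ‖w‖²`; the other half (`h9`) is discarded.
  have h6 := sq_nonneg (σ * ‖w t‖ - |u t| * ‖β‖)
  have h7 : (|u t| * ‖β‖) ^ 2 = u t ^ 2 * ‖β‖ ^ 2 := by rw [mul_pow, sq_abs]
  have h8 : 2 * (-inner ℝ (-KS.opA lam (w t)) (w t) + u t * inner ℝ (w t) β) * σ ≤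
      2 * (-(σ * ‖w t‖ ^ 2) + |u t| * (‖w t‖ * ‖β‖)) * σ := by gcongr
  have h9 : 0 ≤ σ ^ 2 * ‖w t‖ ^ 2 := by positivity
  linarith
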